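/- Let $n>2$ be a finite number. For a set $U$ let $\wp({}^nU)$ be the set of all subsets of ${}^nU$ (the set of $n$-tuples over $U$). Consider on it the Boolean operations $\cup,\cap,\sim,\emptyset,{}^nU$ together with, for $i,j<n$, $$C_iX=\{s:\ s(i|a)\in X\text{ for some }a\in U\},\qquad D_{ij}=\{s:\ s_i=s_j\},\qquad S^i_jX=\{s:\ s(i|s_j)\in X\},$$ where $s(i|a)$ is $s$ with its $i$-th coordinate replaced by $a$. Let $\mathsf{RCA}_n$ (the representable cylindric algebras of dimension $n$) be the class of all algebras isomorphic to a subalgebra of a direct product of algebras $\langle\wp({}^nU),\cup,\cap,\sim,\emptyset,{}^nU,C_i,D_{ij}\rangle_{i,j<n}$, and let $\mathsf{RSC}_n$ (the representable Pinter substitution algebras of dimension $n$) be the class of all algebras isomorphic to a subalgebra of a direct product of algebras $\langle\wp({}^nU),\cup,\cap,\sim,\emptyset,{}^nU,C_i,S^i_j\rangle_{i,j<n}$. For a class $K$ of similar algebras and a cardinal $\beta>0$, let $\mathfrak{Fr}_\beta K$ be the free algebra of $K$ on $\beta$ generators, i.e. the algebra of terms in $\beta$ variables modulo the equations valid in $K$.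 A subset $Y$ of an algebra $\mathfrak A$ is an irredundant generating set if $Y$ generates $\mathfrak A$ and no proper subset of $Y$ does; $Y$ generates $\mathfrak A$ freely (over $K$) if $Y$ generates $\mathfrak A$ and every map from $Y$ into a member $\mathfrak B$ of $K$ extends to a homomorphism $\mathfrak A\to\mathfrak B$. **Theorem.** For every finite $n>2$ and every cardinal $\beta>0$ (finite or infinite), the algebra $\mathfrak{Fr}_\beta\mathsf{RCA}_n$ has an irredundant generating set with exactly $\beta$ elements which does not generate it freely over $\mathsf{RCA}_n$. Likewise, $\mathfrak{Fr}_\beta\mathsf{RSC}_n$ has an irredundant generating set with exactly $\beta$ elements which does not generate it freely over $\mathsf{RSC}_n$. -/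

import Mathlib

universe u

namespace CylindricLike


/-! ### Free algebras over a class of algebras -/

/-- A class of algebras (with carriers in `Type u`) of a given signature. -/
abbrev AlgClass (L : FirstOrder.Language.{0, 0}) : Type (u + 1) :=
  ∀ (A : Type u) [L.Structure A], Prop

section Free

variable {L : FirstOrder.Language.{0, 0}}

/-- Two terms are identified when the corresponding equation is valid in every member of `K`. -/
def identities (K : AlgClass.{u} L) (X : Type u) : Setoid (L.Term X) where
  r s t := ∀ (A : Type u) [L.Structure A], K A → ∀ v : X → A, s.realize v = t.realize v
  iseqv :=
    { refl := fun _ _ _ _ _ => rfl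
      symm := fun h A _ hA v => (h A hA v).symm
      trans := fun h₁ h₂ A _ hA v => (h₁ A hA v).trans (h₂ A hA v) }

/-- The absolutely free term algebra on `X`, together with the fact that the identities of `K`
form a congruence on it. (All signatures used below have no relation symbols.) -/
instance termPrestructure (K : AlgClass.{u} L) (X : Type u) :
    L.Prestructure (identities K X) where
  toStructure :=
    { funMap := fun f x => FirstOrder.Language.Term.func f x
      RelMap := fun _ _ => False }
  fun_equiv := by
    intro k f x y h A _ hA v
    change (FirstOrder.Language.Term.func f x).realize v = (FirstOrder.Language.Term.func f y).realize v
    simp only [FirstOrder.Language.Term.realize_func]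
    congr 1
    funext i
    exact h i A hA v
  rel_equiv := by
    intro k r x y _
    rfl

/-- The free algebra of the class `K` on the generators `X`: terms modulo the identities
of `K`. -/
def FreeAlg (K : AlgClass.{u} L) (X : Type u) : Type u :=
  Quotient (identities K X)

instance (K : AlgClass.{u} L) (X : Type u) : L.Structure (FreeAlg K X) :=
  FirstOrder.Language.quotientStructure (s := identities K X)

/-- `Fr K β` is the `β`-generated free algebra of the class `K`. -/
abbrev Fr (K : AlgClass.{u} L) (β : Cardinal.{u}) : Type u :=
  FreeAlg K β.out

variable (L) in
/-- `Y` generates `A`: the least subalgebra containing `Y` is `A`. -/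
def Generates {A : Type u} [L.Structure A] (Y : Set A) : Prop :=
  FirstOrder.Language.Substructure.closure L Y = ⊤

variable (L) in
/-- `Y` is an irredundant generating set: it generates, but none of its proper subsets does. -/
def IrredundantlyGenerates {A : Type u} [L.Structure A] (Y : Set A) : Prop :=
  Generates L Y ∧ ∀ Z : Set A, Z ⊂ Y → ¬ Generates L Z

/-- `Y` freely generates `A` over `K`: it generates `A`, and every map of `Y` into a
member of `K` extends to a homomorphism on `A`. -/
def FreelyGenerates (K : AlgClass.{u} L) {A : Type u} [L.Structure A] (Y : Set A) : Prop :=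
  Generates L Y ∧
    ∀ (B : Type u) [L.Structure B], K B →
      ∀ f : Y → B, ∃ g : L.Hom A B, ∀ y : Y, g y = f y

end Free

/-! ### Representable cylindric algebras -/

/-- The operation symbols of cylindric algebras of dimension `n`, sorted by arity. -/
inductive CAFunc (n : ℕ) : ℕ → Type
  | zero : CAFunc n 0
  | one : CAFunc n 0
  | diag (i j : Fin n) : CAFunc n 0
  | compl : CAFunc n 1
  | cyl (i : Fin n) : CAFunc n 1
  | sup : CAFunc n 2
  | inf : CAFunc n 2

/-- The signature of cylindric algebras of dimension `n`. -/
def langCA (n : ℕ) : FirstOrder.Language.{0, 0} := ⟨CAFunc n, fun _ => Empty⟩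

/-- The `i`-th cylindrification on subsets of `ⁿU`. -/
def cylindrify {n : ℕ} {U : Type u} (i : Fin n) (X : Set (Fin n → U)) : Set (Fin n → U) :=
  {s | ∃ a : U, Function.update s i a ∈ X}

/-- The substitution operation on subsets of `ⁿU`: replace the `i`-th coordinate by the
`j`-th one. -/
def substitute {n : ℕ} {U : Type u} (i j : Fin n) (X : Set (Fin n → U)) : Set (Fin n → U) :=
  {s | Function.update s i (s j) ∈ X}

/-- The full cylindric set algebra of dimension `n` with base `U`. -/
instance fullCs (n : ℕ) (U : Type u) : (langCA n).Structure (Set (Fin n → U)) where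
  funMap := fun {_} f =>
    match f with
    | CAFunc.zero => fun _ => ∅
    | CAFunc.one => fun _ => Set.univ
    | CAFunc.diag i j => fun _ => {s | s i = s j}
    | CAFunc.compl => fun x => (x 0)ᶜ
    | CAFunc.cyl i => fun x => cylindrify i (x 0)
    | CAFunc.sup => fun x => x 0 ∪ x 1
    | CAFunc.inf => fun x => x 0 ∩ x 1
  RelMap := fun r => nomatch r

/-- `RCA n`: the algebras isomorphic to a subalgebra of a direct product of full cylindric set
algebras. An embedding into a direct product is given as a jointly injective family of
homomorphisms into the factors. -/
def RCA (n : ℕ) : AlgClass.{u} (langCA n) := fun A _ =>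
  ∃ (I : Type u) (U : I → Type u) (h : ∀ i, (langCA n).Hom A (Set (Fin n → U i))),
    Function.Injective fun (a : A) (i : I) => h i a

/-! ### Representable substitution algebras in the sense of Pinter -/

/-- The operation symbols of Pinter's substitution algebras of dimension `n`, sorted by
arity. -/
inductive SCFunc (n : ℕ) : ℕ → Type
  | zero : SCFunc n 0
  | one : SCFunc n 0
  | compl : SCFunc n 1
  | cyl (i : Fin n) : SCFunc n 1
  | subst (i j : Fin n) : SCFunc n 1
  | sup : SCFunc n 2
  | inf : SCFunc n 2

/-- The signature of Pinter's substitution algebras of dimension `n`. -/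
def langSC (n : ℕ) : FirstOrder.Language.{0, 0} := ⟨SCFunc n, fun _ => Empty⟩

/-- The full substitution set algebra of dimension `n` with base `U`. -/
instance fullSubstAlg (n : ℕ) (U : Type u) : (langSC n).Structure (Set (Fin n → U)) where
  funMap := fun {_} f =>
    match f with
    | SCFunc.zero => fun _ => ∅
    | SCFunc.one => fun _ => Set.univ
    | SCFunc.compl => fun x => (x 0)ᶜ
    | SCFunc.cyl i => fun x => cylindrify i (x 0)
    | SCFunc.subst i j => fun x => substitute i j (x 0)
    | SCFunc.sup => fun x => x 0 ∪ x 1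
    | SCFunc.inf => fun x => x 0 ∩ x 1
  RelMap := fun r => nomatch r

/-- `RSC n`: the algebras isomorphic to a subalgebra of a direct product of full substitution
set algebras. -/
def RSC (n : ℕ) : AlgClass.{u} (langSC n) := fun A _ =>
  ∃ (I : Type u) (U : I → Type u) (h : ∀ i, (langSC n).Hom A (Set (Fin n → U i))),
    Function.Injective fun (a : A) (i : I) => h i a

end CylindricLike

/-! Suppose unary terms `τ`, `σ` satisfy σ(τ(x)) = x throughout the class, while `τ` misses an
element b of some member B. Replace one free generator x₀ by τ(x₀). The new set still generates,
since `σ` recovers x₀. Homomorphisms into B show that no element can be dropped. It is not free: a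
homomorphism sending every element of it to b would put b in the range of `τ`. This is
`exists_irredundantlyGenerates_not_freelyGenerates`.

To get `τ`, read a relation as a pair (S, A), S binary and A unary, on three separate coordinates.
If S behaves like an injection, `condShift` replaces A by its S-image and `condUnshift` takes the
preimage; all other relations are fixed. Shifting keeps S and preserves `IsCode`, so the inverse
knows which case applies (`condUnshift_condShift`). Successor on ℕ with A = {0} is not in the range
(`exists_condShift_ne`).

Both maps are definable with three variables and without equality, so the same definitions yield
terms in both signatures. Subalgebras of products inherit the identity σ(τ(x)) = x. -/

namespace CylindricLike

open FirstOrder FirstOrder.Language Cardinal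

/-! ### Homomorphisms out of free algebras and non-free generating sets -/

section Free

variable {L : FirstOrder.Language.{0, 0}} {K : AlgClass.{u} L} {X : Type u}

/-- The generator of the free algebra that belongs to a variable. -/
def FreeAlg.of (K : AlgClass.{u} L) (x : X) : FreeAlg K X :=
  Quotient.mk (identities K X) (Term.var x)

theorem FreeAlg.realize_of (t : L.Term X) :
    t.realize (FreeAlg.of K) = Quotient.mk (identities K X) t := by
  refine (Term.realize_quotient_mk' (identities K X) t Term.var).trans ?_
  congr 1
  induction t with
  | var => rfl
  | func f ts ih => exact congrArg (Term.func f) (funext ih)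

/-- The homomorphism from the free algebra to a member of the class that is induced by a
valuation of the variables. -/
def FreeAlg.lift {A : Type u} [L.Structure A] (hA : K A) (v : X → A) : L.Hom (FreeAlg K X) A where
  toFun := Quotient.lift (fun t : L.Term X => t.realize v)
    fun t₁ t₂ (h : identities K X t₁ t₂) => h A hA v
  map_fun' := by
    intro k f x
    induction x using Quotient.induction_on_pi with
    | _ x =>
      have := funMap_quotient_mk' (L := L) (identities K X) f x
      exact congrArg (Quotient.lift (fun t : L.Term X => t.realize v)
        fun t₁ t₂ (h : identities K X t₁ t₂) => h A hA v) this
  map_rel' := by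
    intro k r x
    induction x using Quotient.induction_on_pi with
    | _ x => exact fun h => ((relMap_quotient_mk' (L := L) (identities K X) r x).1 h).elim

@[simp]
theorem FreeAlg.lift_of {A : Type u} [L.Structure A] (hA : K A) (v : X → A) (x : X) :
    FreeAlg.lift hA v (FreeAlg.of K x) = v x := rfl

/-- If `σ` undoes `τ` throughout `K`, and `τ` is not surjective on some member of `K`, then
replacing a single free generator by its image under `τ` gives an irredundant generating set of
the same size which is not free. -/
theorem exists_irredundantlyGenerates_not_freelyGenerates (τ σ : L.Term PUnit.{1})
    (hστ : ∀ (A : Type u) [L.Structure A], K A → ∀ a : A,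
      σ.realize (fun _ => τ.realize fun _ => a) = a)
    {B : Type u} [L.Structure B] (hB : K B) {b : B} (hb : ∀ a : B, τ.realize (fun _ => a) ≠ b)
    (x₀ : X) :
    ∃ Y : Set (FreeAlg K X), #Y = #X ∧ IrredundantlyGenerates L Y ∧ ¬ FreelyGenerates K Y := by
  classical
  let y : X → FreeAlg K X := fun x =>
    if x = x₀ then τ.realize fun _ => FreeAlg.of K x₀ else FreeAlg.of K x
  have lift_y (v : X → B) (x : X) :
      FreeAlg.lift hB v (y x) = if x = x₀ then τ.realize (fun _ => v x₀) else v x := by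
    by_cases hx : x = x₀
    · simp only [y, if_pos hx]
      exact (HomClass.realize_term (FreeAlg.lift hB v)).symm
    · simp only [y, if_neg hx, FreeAlg.lift_of]
  have τ_inj : Function.Injective fun a : B => τ.realize fun _ => a :=
    Function.LeftInverse.injective (g := fun a : B => σ.realize fun _ => a) (hστ B hB)
  -- The valuations differ only at `z`, with values b and τ(b), distinct because b is outside the
  -- range of `τ`. At `z = x₀` the images are τ(b) and τ(τ(b)), distinct by injectivity of `τ`.
  have separate (z : X) : ∃ f g : L.Hom (FreeAlg K X) B,
      (∀ x, x ≠ z → f (y x) = g (y x)) ∧ f (y z) ≠ g (y z) := by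
    refine ⟨FreeAlg.lift hB fun _ => b,
      FreeAlg.lift hB (Function.update (fun _ => b) z (τ.realize fun _ => b)), ?_, ?_⟩
    · intro x hx
      rw [lift_y, lift_y]
      split_ifs with h
      · subst h
        rw [Function.update_of_ne hx]
      · rw [Function.update_of_ne hx]
    · rw [lift_y, lift_y]
      split_ifs with h
      · subst h
        rw [Function.update_self]
        exact fun h => hb b (τ_inj h).symm
      · rw [Function.update_self]
        exact (hb b).symm
  have y_inj : Function.Injective y := by
    intro x z hxz
    by_contra hne
    obtain ⟨f, g, hfg, hne'⟩ := separate z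
    exact hne' (by rw [← hxz]; exact hfg x hne)
  have of_eq : σ.realize (fun _ => y x₀) = FreeAlg.of K x₀ := by
    -- Computing with terms modulo identities avoids having to know that the free algebra lies in
    -- `K`.
    let t : L.Term X := (σ.subst fun _ => τ).relabel fun _ => x₀
    have h₁ : t.realize (FreeAlg.of K) = σ.realize (fun _ => y x₀) := by
      simp only [t, y, Term.realize_relabel, Term.realize_subst, if_true]
      rfl
    rw [← h₁, FreeAlg.realize_of]
    refine Quotient.sound fun A _ hA v => ?_
    simp only [t, Term.realize_relabel, Term.realize_subst, Term.realize_var]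
    exact hστ A hA (v x₀)
  have gen : Generates L (Set.range y) := by
    have mem (x : X) : FreeAlg.of K x ∈ Substructure.closure L (Set.range y) := by
      by_cases hx : x = x₀
      · rw [hx, ← of_eq]
        exact Term.realize_mem _ _ fun _ => Substructure.subset_closure ⟨x₀, rfl⟩
      · exact Substructure.subset_closure ⟨x, if_neg hx⟩
    refine eq_top_iff.2 fun a _ => ?_
    induction a using Quotient.inductionOn with
    | _ t =>
      rw [← FreeAlg.realize_of]
      exact Term.realize_mem _ _ mem
  refine ⟨Set.range y, mk_range_eq y y_inj, ⟨gen, fun Z hZ hgen => ?_⟩, fun hfree => ?_⟩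
  · obtain ⟨hZY, w, ⟨z, rfl⟩, hz⟩ := Set.ssubset_iff_exists.1 hZ
    obtain ⟨f, g, hfg, hne⟩ := separate z
    refine hne (DFunLike.congr_fun (Hom.eq_of_eqOn_dense hgen fun a ha => ?_) _)
    obtain ⟨x, rfl⟩ := hZY ha
    exact hfg x fun hx => hz (hx ▸ ha)
  · obtain ⟨g, hg⟩ := hfree.2 B hB fun _ => b
    apply hb (g (FreeAlg.of K x₀))
    rw [← hg ⟨y x₀, x₀, rfl⟩]
    simp only [y, if_true]
    exact HomClass.realize_term g

end Free

/-! ### Term-definable operations on full set algebras -/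

section Definable

variable {n : ℕ}

/-- The unary operations on full set algebras that are given by terms in the operations of
substitution algebras. -/
inductive SubstDefinable (n : ℕ) : ((U : Type u) → Set (Fin n → U) → Set (Fin n → U)) → Prop
  | id : SubstDefinable n fun _ R => R
  | compl {F} : SubstDefinable n F → SubstDefinable n fun U R => (F U R)ᶜ
  | inter {F G} : SubstDefinable n F → SubstDefinable n G →
      SubstDefinable n fun U R => F U R ∩ G U R
  | cylindrify {F} (i : Fin n) : SubstDefinable n F →
      SubstDefinable n fun U R => cylindrify i (F U R)
  | substitute {F} (i j : Fin n) : SubstDefinable n F →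
      SubstDefinable n fun U R => substitute i j (F U R)

theorem substitute_self {U : Type u} (i : Fin n) (X : Set (Fin n → U)) : substitute i i X = X := by
  ext s
  simp [substitute]

theorem substitute_eq_cylindrify {U : Type u} {i j : Fin n} (hij : i ≠ j) (X : Set (Fin n → U)) :
    substitute i j X = cylindrify i ({s | s i = s j} ∩ X) := by
  ext s
  constructor
  · intro h
    exact ⟨s j, by simp [Function.update_of_ne hij.symm], h⟩
  · rintro ⟨a, ha, h⟩
    have ha' : a = s j := by simpa [Function.update_of_ne hij.symm] using ha
    exact (ha' ▸ h : Function.update s i (s j) ∈ X)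

theorem SubstDefinable.exists_term_langSC
    {F : (U : Type u) → Set (Fin n → U) → Set (Fin n → U)} (h : SubstDefinable n F) :
    ∃ t : (langSC n).Term PUnit.{1}, ∀ (U : Type u) (R : Set (Fin n → U)),
      t.realize (fun _ => R) = F U R := by
  induction h with
  | id => exact ⟨Term.var ⟨⟩, fun _ _ => rfl⟩
  | compl _ ih =>
    obtain ⟨t, ht⟩ := ih
    refine ⟨Term.func (L := langSC n) SCFunc.compl ![t], fun U R => congrArg (·ᶜ) (ht U R)⟩
  | inter _ _ ih₁ ih₂ =>
    obtain ⟨t₁, ht₁⟩ := ih₁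
    obtain ⟨t₂, ht₂⟩ := ih₂
    refine ⟨Term.func (L := langSC n) SCFunc.inf ![t₁, t₂], fun U R =>
      congrArg₂ (· ∩ ·) (ht₁ U R) (ht₂ U R)⟩
  | cylindrify i _ ih =>
    obtain ⟨t, ht⟩ := ih
    refine ⟨Term.func (L := langSC n) (SCFunc.cyl i) ![t], fun U R =>
      congrArg (CylindricLike.cylindrify i) (ht U R)⟩
  | substitute i j _ ih =>
    obtain ⟨t, ht⟩ := ih
    refine ⟨Term.func (L := langSC n) (SCFunc.subst i j) ![t], fun U R =>
      congrArg (CylindricLike.substitute i j) (ht U R)⟩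

theorem SubstDefinable.exists_term_langCA
    {F : (U : Type u) → Set (Fin n → U) → Set (Fin n → U)} (h : SubstDefinable n F) :
    ∃ t : (langCA n).Term PUnit.{1}, ∀ (U : Type u) (R : Set (Fin n → U)),
      t.realize (fun _ => R) = F U R := by
  induction h with
  | id => exact ⟨Term.var ⟨⟩, fun _ _ => rfl⟩
  | compl _ ih =>
    obtain ⟨t, ht⟩ := ih
    refine ⟨Term.func (L := langCA n) CAFunc.compl ![t], fun U R => congrArg (·ᶜ) (ht U R)⟩
  | inter _ _ ih₁ ih₂ =>
    obtain ⟨t₁, ht₁⟩ := ih₁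
    obtain ⟨t₂, ht₂⟩ := ih₂
    refine ⟨Term.func (L := langCA n) CAFunc.inf ![t₁, t₂], fun U R =>
      congrArg₂ (· ∩ ·) (ht₁ U R) (ht₂ U R)⟩
  | cylindrify i _ ih =>
    obtain ⟨t, ht⟩ := ih
    refine ⟨Term.func (L := langCA n) (CAFunc.cyl i) ![t], fun U R =>
      congrArg (CylindricLike.cylindrify i) (ht U R)⟩
  | substitute i j _ ih =>
    obtain ⟨t, ht⟩ := ih
    -- For `i = j` the diagonal is everything, and the cylindrified meet would be the
    -- cylindrification rather than the identity.
    by_cases hij : i = j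
    · subst hij
      exact ⟨t, fun U R => (ht U R).trans (substitute_self i _).symm⟩
    · refine ⟨Term.func (L := langCA n) (CAFunc.cyl i) ![Term.func (L := langCA n) CAFunc.inf
        ![Term.func (L := langCA n) (CAFunc.diag i j) ![], t] ],
        fun U R => Eq.trans ?_ (substitute_eq_cylindrify hij _).symm⟩
      exact congrArg (fun X => CylindricLike.cylindrify i ({s | s i = s j} ∩ X)) (ht U R)

/-- A property of tuples, depending on a given relation, that is definable by a term in the
operations of substitution algebras. -/
def DefinablePred (n : ℕ) (φ : (U : Type u) → Set (Fin n → U) → (Fin n → U) → Prop) : Prop :=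
  SubstDefinable n fun U R => {s | φ U R s}

namespace DefinablePred

variable {φ ψ : (U : Type u) → Set (Fin n → U) → (Fin n → U) → Prop}

theorem congr (h : DefinablePred n φ) (hφψ : ∀ U R s, φ U R s ↔ ψ U R s) : DefinablePred n ψ := by
  have : φ = ψ := by
    funext U R s
    exact propext (hφψ U R s)
  exact this ▸ h

theorem mem : DefinablePred n fun _ R s => s ∈ R := SubstDefinable.id

theorem not (h : DefinablePred n φ) : DefinablePred n fun U R s => ¬ φ U R s :=
  SubstDefinable.compl h

theorem and (hφ : DefinablePred n φ) (hψ : DefinablePred n ψ) :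
    DefinablePred n fun U R s => φ U R s ∧ ψ U R s :=
  SubstDefinable.inter hφ hψ

theorem or (hφ : DefinablePred n φ) (hψ : DefinablePred n ψ) :
    DefinablePred n fun U R s => φ U R s ∨ ψ U R s :=
  (hφ.not.and hψ.not).not.congr fun _ _ _ => by tauto

theorem imp (hφ : DefinablePred n φ) (hψ : DefinablePred n ψ) :
    DefinablePred n fun U R s => φ U R s → ψ U R s :=
  (hφ.and hψ.not).not.congr fun _ _ _ => by tauto

theorem exists_update (h : DefinablePred n φ) (i : Fin n) :
    DefinablePred n fun U R s => ∃ a, φ U R (Function.update s i a) :=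
  SubstDefinable.cylindrify i h

theorem subst (h : DefinablePred n φ) (i j : Fin n) :
    DefinablePred n fun U R s => φ U R (Function.update s i (s j)) :=
  SubstDefinable.substitute i j h

/-- Taking `Γ` to be everything gives closed statements; taking the complement of one or two
coordinates gives the projections `unProj` and `binProj`. -/
theorem exists_eq_off (h : DefinablePred n φ) (Γ : Finset (Fin n)) :
    DefinablePred n fun U R s => ∃ t, φ U R t ∧ ∀ j ∉ Γ, t j = s j := by
  induction Γ using Finset.induction_on with
  | empty =>
    refine h.congr fun U R s => ⟨fun hs => ⟨s, hs, fun _ _ => rfl⟩, ?_⟩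
    rintro ⟨t, ht, hts⟩
    rwa [← funext fun j => hts j (Finset.notMem_empty j)]
  | insert i Γ _ ih =>
    refine (ih.exists_update i).congr fun U R s => ⟨?_, ?_⟩
    · rintro ⟨a, t, ht, hts⟩
      refine ⟨t, ht, fun j hj => ?_⟩
      rw [Finset.mem_insert, not_or] at hj
      rw [hts j hj.2, Function.update_of_ne hj.1]
    · rintro ⟨t, ht, hts⟩
      refine ⟨t i, t, ht, fun j hj => ?_⟩
      by_cases hji : j = i
      · rw [hji, Function.update_self]
      · rw [Function.update_of_ne hji]
        exact hts j (by simp [hji, hj])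

theorem exists_tuple (h : DefinablePred n φ) : DefinablePred n fun U R _ => ∃ t, φ U R t :=
  (h.exists_eq_off Finset.univ).congr fun _ _ _ => by simp

theorem forall_tuple (h : DefinablePred n φ) : DefinablePred n fun U R _ => ∀ t, φ U R t :=
  h.not.exists_tuple.not.congr fun _ _ _ => by simp

theorem unary {p : (U : Type u) → Set (Fin n → U) → U → Prop} {i : Fin n}
    (h : DefinablePred n fun U R s => p U R (s i)) (j : Fin n) :
    DefinablePred n fun U R s => p U R (s j) :=
  (h.subst i j).congr fun U R s => by rw [Function.update_self]

theorem binary_left {p : (U : Type u) → Set (Fin n → U) → U → U → Prop} {i j : Fin n}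
    (h : DefinablePred n fun U R s => p U R (s i) (s j)) (hij : i ≠ j) (k : Fin n) :
    DefinablePred n fun U R s => p U R (s k) (s j) :=
  (h.subst i k).congr fun U R s => by rw [Function.update_self, Function.update_of_ne hij.symm]

theorem binary_right {p : (U : Type u) → Set (Fin n → U) → U → U → Prop} {i j : Fin n}
    (h : DefinablePred n fun U R s => p U R (s i) (s j)) (hij : i ≠ j) (k : Fin n) :
    DefinablePred n fun U R s => p U R (s i) (s k) :=
  (h.subst j k).congr fun U R s => by rw [Function.update_self, Function.update_of_ne hij]

/-- With a third coordinate at hand, a binary relation definable on one pair of coordinates is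
definable on all pairs of distinct coordinates. -/
theorem binary {p : (U : Type u) → Set (Fin n → U) → U → U → Prop} (hn : 2 < n) {i j : Fin n}
    (h : DefinablePred n fun U R s => p U R (s i) (s j)) (hij : i ≠ j) (k l : Fin n) :
    DefinablePred n fun U R s => p U R (s k) (s l) := by
  by_cases hkj : k = j
  · subst hkj
    obtain ⟨m, hm⟩ : ∃ m, m ∉ ({i, k} : Finset (Fin n)) := by
      by_contra! hall
      have := Finset.card_le_card (fun m _ => hall m : Finset.univ ⊆ ({i, k} : Finset (Fin n)))
      have := Finset.card_le_two (a := i) (b := k)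
      simp only [Finset.card_univ, Fintype.card_fin] at *
      omega
    simp only [Finset.mem_insert, Finset.mem_singleton, not_or] at hm
    -- The pair of coordinates moves (i, k) → (i, m) → (k, m) → (k, l): the spare `m` vacates `k`
    -- before the left argument moves there.
    exact ((h.binary_right hij m).binary_left (Ne.symm hm.1) k).binary_right (Ne.symm hm.2) l
  · exact (h.binary_left hij k).binary_right hkj l

end DefinablePred

end Definable

/-! ### Shifting a subset along an injection

A relation of the form `{s | S (s 0) (s 1) ∧ A (s 2)}` codes a binary relation `S` and a
set `A`. If `S` behaves like an injection, `A` can be replaced by its image under `S`, and be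
recovered as the inverse image. -/

section Shift

variable {n : ℕ} {U : Type u} {i j k : Fin n} {R : Set (Fin n → U)}

/-- The projection of a relation to two coordinates. -/
def binProj (i j : Fin n) (R : Set (Fin n → U)) (x y : U) : Prop := ∃ t ∈ R, t i = x ∧ t j = y

/-- The projection of a relation to one coordinate. -/
def unProj (k : Fin n) (R : Set (Fin n → U)) (z : U) : Prop := ∃ t ∈ R, t k = z

/-- The relation on tuples coding a binary relation and a set. -/
def code (i j k : Fin n) (S : U → U → Prop) (A : U → Prop) : Set (Fin n → U) :=
  {s | S (s i) (s j) ∧ A (s k)}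

/-- `S` is total, behaves like an injection modulo indiscernibility, and `A` respects this
indiscernibility. -/
structure IsShiftable (S : U → U → Prop) (A : U → Prop) : Prop where
  total : ∀ x, ∃ y, S x y
  closed : ∀ x y z, A x → S x y → S z y → A z
  -- This makes `closed` survive passing to the S-image of `A`. As `w` is quantified inside the
  -- premise, it can share a coordinate with `z`.
  comp_closed : ∀ x y z, (∃ w, S x w ∧ S w y) → S z y → S x z

/-- The given relation codes a shiftable pair. -/
def IsCode (i j k : Fin n) (R : Set (Fin n → U)) : Prop :=
  code i j k (binProj i j R) (unProj k R) ⊆ R ∧ IsShiftable (binProj i j R) (unProj k R)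

/-- Replace the coded set by its image. -/
def shift (i j k : Fin n) (R : Set (Fin n → U)) : Set (Fin n → U) :=
  code i j k (binProj i j R) fun z => ∃ x, binProj i j R x z ∧ unProj k R x

/-- Replace the coded set by its inverse image. -/
def unshift (i j k : Fin n) (R : Set (Fin n → U)) : Set (Fin n → U) :=
  code i j k (binProj i j R) fun x => ∃ y, binProj i j R x y ∧ unProj k R y

/-- An empty `A` would make the code empty and lose `S`; hence the hypothesis `hA`. -/
theorem binProj_code (hij : i ≠ j) (hik : i ≠ k) (hjk : j ≠ k) {S : U → U → Prop} {A : U → Prop}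
    (hA : ∀ x y, S x y → ∃ z, A z) : binProj i j (code i j k S A) = S := by
  funext x y
  refine propext ⟨?_, fun h => ?_⟩
  · rintro ⟨t, ht, rfl, rfl⟩
    exact ht.1
  · obtain ⟨z, hz⟩ := hA x y h
    refine ⟨Function.update (Function.update (fun _ => z) i x) j y, ?_, ?_, ?_⟩ <;>
      simp [code, hij, hik.symm, hjk.symm, h, hz]

theorem unProj_code (hij : i ≠ j) (hik : i ≠ k) (hjk : j ≠ k) {S : U → U → Prop} {A : U → Prop}
    (hS : ∀ z, A z → ∃ x y, S x y) : unProj k (code i j k S A) = A := by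
  funext z
  refine propext ⟨?_, fun h => ?_⟩
  · rintro ⟨t, ht, rfl⟩
    exact ht.2
  · obtain ⟨x, y, hxy⟩ := hS z h
    refine ⟨Function.update (Function.update (fun _ => z) i x) j y, ?_, ?_⟩ <;>
      simp [code, hij, hik.symm, hjk.symm, h, hxy]

theorem IsCode.code_eq (h : IsCode i j k R) : code i j k (binProj i j R) (unProj k R) = R :=
  h.1.antisymm fun s hs => ⟨⟨s, hs, rfl, rfl⟩, s, hs, rfl⟩

theorem IsCode.binProj_shift (hij : i ≠ j) (hik : i ≠ k) (hjk : j ≠ k) (h : IsCode i j k R) :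
    binProj i j (shift i j k R) = binProj i j R := by
  refine binProj_code hij hik hjk ?_
  rintro x y ⟨t, ht, -⟩
  obtain ⟨z, hz⟩ := h.2.total (t k)
  exact ⟨z, t k, hz, t, ht, rfl⟩

theorem unProj_shift (hij : i ≠ j) (hik : i ≠ k) (hjk : j ≠ k) (R : Set (Fin n → U)) :
    unProj k (shift i j k R) = fun z => ∃ x, binProj i j R x z ∧ unProj k R x :=
  unProj_code hij hik hjk fun z ⟨x, hx, _⟩ => ⟨x, z, hx⟩

theorem IsCode.shift (hij : i ≠ j) (hik : i ≠ k) (hjk : j ≠ k) (h : IsCode i j k R) :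
    IsCode i j k (shift i j k R) := by
  unfold IsCode
  rw [h.binProj_shift hij hik hjk, unProj_shift hij hik hjk]
  refine ⟨subset_rfl, h.2.total, ?_, h.2.comp_closed⟩
  rintro x y z ⟨a, hax, ha⟩ hxy hzy
  exact ⟨a, h.2.comp_closed a y z ⟨x, hax, hxy⟩ hzy, ha⟩

theorem IsCode.unshift_shift (hij : i ≠ j) (hik : i ≠ k) (hjk : j ≠ k) (h : IsCode i j k R) :
    unshift i j k (CylindricLike.shift i j k R) = R := by
  unfold unshift
  rw [h.binProj_shift hij hik hjk, unProj_shift hij hik hjk]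
  conv_rhs => rw [← h.code_eq]
  congr 1
  funext x
  refine propext ⟨?_, fun hx => ?_⟩
  · rintro ⟨y, hxy, a, hay, ha⟩
    exact h.2.closed a y x ha hay hxy
  · obtain ⟨y, hy⟩ := h.2.total x
    exact ⟨y, hy, x, hy, hx⟩

/-- Shift the coded set if the relation is a code, and keep the relation unchanged otherwise. -/
def condShift (i j k : Fin n) (R : Set (Fin n → U)) : Set (Fin n → U) :=
  {s | IsCode i j k R ∧ s ∈ shift i j k R ∨ ¬ IsCode i j k R ∧ s ∈ R}

/-- Shift the coded set back if the relation is a code, and keep the relation unchanged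
otherwise. -/
def condUnshift (i j k : Fin n) (R : Set (Fin n → U)) : Set (Fin n → U) :=
  {s | IsCode i j k R ∧ s ∈ unshift i j k R ∨ ¬ IsCode i j k R ∧ s ∈ R}

theorem condShift_of_isCode (h : IsCode i j k R) : condShift i j k R = shift i j k R := by
  ext s
  simp [condShift, h]

theorem condShift_of_not_isCode (h : ¬ IsCode i j k R) : condShift i j k R = R := by
  ext s
  simp [condShift, h]

theorem condUnshift_condShift (hij : i ≠ j) (hik : i ≠ k) (hjk : j ≠ k) (R : Set (Fin n → U)) :
    condUnshift i j k (condShift i j k R) = R := by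
  by_cases h : IsCode i j k R
  · rw [condShift_of_isCode h]
    ext s
    simp [condUnshift, h.shift hij hik hjk, h.unshift_shift hij hik hjk]
  · rw [condShift_of_not_isCode h]
    ext s
    simp [condUnshift, h]

/-- The code of (successor, {0}) is no shift, since 0 is not a successor, and no fixed non-code,
being itself a code. -/
theorem exists_condShift_ne (hij : i ≠ j) (hik : i ≠ k) (hjk : j ≠ k) :
    ∃ b : Set (Fin n → ULift.{u} ℕ), ∀ R, condShift i j k R ≠ b := by
  let S : ULift.{u} ℕ → ULift.{u} ℕ → Prop := fun x y => y.down = x.down + 1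
  let A : ULift.{u} ℕ → Prop := fun z => z.down = 0
  have hS : binProj i j (code i j k S A) = S := binProj_code hij hik hjk fun _ _ _ => ⟨⟨0⟩, rfl⟩
  have hA : unProj k (code i j k S A) = A :=
    unProj_code hij hik hjk fun _ _ => ⟨⟨0⟩, ⟨1⟩, rfl⟩
  have hcode : IsCode i j k (code i j k S A) := by
    unfold IsCode
    rw [hS, hA]
    refine ⟨subset_rfl, fun x => ⟨⟨x.down + 1⟩, rfl⟩, ?_, ?_⟩
    · simp only [S, A]
      intro x y z hx hxy hzy
      omega
    · simp only [S]
      rintro x y z ⟨w, hxw, hwy⟩ hzy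
      omega
  refine ⟨code i j k S A, fun R hR => ?_⟩
  by_cases h : IsCode i j k R
  · rw [condShift_of_isCode h] at hR
    have h₁ := h.binProj_shift hij hik hjk
    have h₂ := unProj_shift hij hik hjk R
    rw [hR] at h₁ h₂
    rw [hS] at h₁
    rw [hA] at h₂
    have h₀ : A ⟨0⟩ := rfl
    rw [h₂] at h₀
    obtain ⟨x, hx, -⟩ := h₀
    rw [← h₁] at hx
    exact Nat.succ_ne_zero _ hx.symm
  · exact h (condShift_of_not_isCode h ▸ hR ▸ hcode)

end Shift

/-! ### Definability of the shift and its inverse -/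

section ShiftDefinable

variable {n : ℕ} {i j k : Fin n}

open DefinablePred

theorem definablePred_binProj (i j : Fin n) :
    DefinablePred.{u} n fun _ R s => binProj i j R (s i) (s j) :=
  (mem.exists_eq_off ({i, j} : Finset (Fin n))ᶜ).congr fun _ _ _ => by
    simp only [binProj, Finset.mem_compl, not_not, Finset.mem_insert, Finset.mem_singleton,
      forall_eq_or_imp, forall_eq]

theorem definablePred_unProj (k l : Fin n) : DefinablePred.{u} n fun _ R s => unProj k R (s l) :=
  ((mem.exists_eq_off ({k} : Finset (Fin n))ᶜ).congr fun _ _ _ => by simp [unProj] :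
    DefinablePred n fun _ R s => unProj k R (s k)).unary l

theorem definablePred_shift (hij : i ≠ j) (hik : i ≠ k) (hn : 2 < n) :
    DefinablePred.{u} n fun _ R s => s ∈ shift i j k R :=
  have hS := (definablePred_binProj.{u} i j).binary hn hij
  (definablePred_binProj i j).and <|
    -- Coordinate `i` holds the bound variable: the second conjunct depends on `s` only through `s
    -- k`.
    (((hS i k).and (definablePred_unProj k i)).exists_update i).congr fun _ _ s => by
      simp [hik.symm]

theorem definablePred_unshift (hij : i ≠ j) (hik : i ≠ k) (hn : 2 < n) :
    DefinablePred.{u} n fun _ R s => s ∈ unshift i j k R :=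
  have hS := (definablePred_binProj.{u} i j).binary hn hij
  (definablePred_binProj i j).and <|
    (((hS k i).and (definablePred_unProj k i)).exists_update i).congr fun _ _ s => by
      simp [hik.symm]

theorem forall_tuple_iff {U : Type u} (hij : i ≠ j) (hik : i ≠ k) (hjk : j ≠ k)
    (p : U → U → U → Prop) :
    (∀ t : Fin n → U, p (t i) (t j) (t k)) ↔ ∀ x y z, p x y z := by
  refine ⟨fun h x y z => ?_, fun h t => h _ _ _⟩
  have := h (Function.update (Function.update (fun _ => z) i x) j y)
  simpa [hij, hik.symm, hjk.symm] using this

theorem definablePred_isCode (hij : i ≠ j) (hik : i ≠ k) (hjk : j ≠ k) (hn : 2 < n) :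
    DefinablePred.{u} n fun _ R _ => IsCode i j k R := by
  have hS := (definablePred_binProj.{u} i j).binary hn hij
  have hA := definablePred_unProj.{u} k
  have hcode : DefinablePred.{u} n fun _ R _ => code i j k (binProj i j R) (unProj k R) ⊆ R :=
    (((hS i j).and (hA k)).imp mem).forall_tuple
  have htotal : DefinablePred.{u} n fun _ R _ => ∀ x, ∃ y, binProj i j R x y :=
    ((hS i j).exists_update j).forall_tuple.congr fun U R _ => by
      simp only [Function.update_of_ne hij, Function.update_self]
      exact ⟨fun h x => h fun _ => x, fun h t => h (t i)⟩
  have hclosed : DefinablePred.{u} n fun _ R _ =>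
      ∀ x y z, unProj k R x → binProj i j R x y → binProj i j R z y → unProj k R z :=
    ((hA i).imp ((hS i j).imp ((hS k j).imp (hA k)))).forall_tuple.congr fun U R _ =>
      forall_tuple_iff hij hik hjk fun x y z =>
        unProj k R x → binProj i j R x y → binProj i j R z y → unProj k R z
  have hcomp : DefinablePred.{u} n fun _ R _ => ∀ x y z,
      (∃ w, binProj i j R x w ∧ binProj i j R w y) → binProj i j R z y → binProj i j R x z :=
    -- Coordinate `k` serves twice, for the bound `w` in the premise and for `z` outside it.
    ((((hS i k).and (hS k j)).exists_update k).imp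
      ((hS k j).imp (hS i k))).forall_tuple.congr fun U R _ => by
        simpa [hik, hjk] using forall_tuple_iff hij hik hjk fun x y z =>
          (∃ w, binProj i j R x w ∧ binProj i j R w y) → binProj i j R z y → binProj i j R x z
  exact (hcode.and (htotal.and (hclosed.and hcomp))).congr fun U R _ =>
    ⟨fun h => ⟨h.1, h.2.1, h.2.2.1, h.2.2.2⟩, fun h => ⟨h.1, h.2.1, h.2.2, h.2.3⟩⟩

theorem substDefinable_condShift (hij : i ≠ j) (hik : i ≠ k) (hjk : j ≠ k) (hn : 2 < n) :
    SubstDefinable.{u} n fun _ R => condShift i j k R :=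
  have hcode := definablePred_isCode.{u} hij hik hjk hn
  (hcode.and (definablePred_shift hij hik hn)).or (hcode.not.and mem)

theorem substDefinable_condUnshift (hij : i ≠ j) (hik : i ≠ k) (hjk : j ≠ k) (hn : 2 < n) :
    SubstDefinable.{u} n fun _ R => condUnshift i j k R :=
  have hcode := definablePred_isCode.{u} hij hik hjk hn
  (hcode.and (definablePred_unshift hij hik hn)).or (hcode.not.and mem)

end ShiftDefinable

/-! ### From full set algebras to representable algebras -/

section Representable

/-- An algebra with a jointly injective family of homomorphisms inherits the identities of the
targets. -/
theorem realize_realize_eq_of_jointly_injective {L : FirstOrder.Language.{0, 0}}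
    {τ σ : L.Term PUnit.{1}} {A : Type u} [L.Structure A] {I : Type u} {B : I → Type u}
    [∀ i, L.Structure (B i)] (h : ∀ i, L.Hom A (B i))
    (hinj : Function.Injective fun (a : A) (i : I) => h i a)
    (hB : ∀ i (b : B i), σ.realize (fun _ => τ.realize fun _ => b) = b) (a : A) :
    σ.realize (fun _ => τ.realize fun _ => a) = a := by
  refine hinj (funext fun i => ?_)
  have hτ : h i (τ.realize fun _ => a) = τ.realize fun _ => h i a :=
    (HomClass.realize_term (h i)).symm
  have hσ : h i (σ.realize fun _ => τ.realize fun _ => a) =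
      σ.realize fun _ => h i (τ.realize fun _ => a) :=
    (HomClass.realize_term (h i)).symm
  simp only [hσ, hτ, hB]

theorem RCA_fullCs (n : ℕ) (U : Type u) : RCA n (Set (Fin n → U)) :=
  ⟨PUnit, fun _ => U, fun _ => Hom.id _ _, fun _ _ h => congrFun h ⟨⟩⟩

theorem RSC_fullSubstAlg (n : ℕ) (U : Type u) : RSC n (Set (Fin n → U)) :=
  ⟨PUnit, fun _ => U, fun _ => Hom.id _ _, fun _ _ h => congrFun h ⟨⟩⟩

end Representable

end CylindricLike

theorem mainTheorem1 (n : ℕ) (hn : 2 < n) (β : Cardinal.{u}) (hβ : 0 < β) :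
    (∃ Y : Set (CylindricLike.Fr (CylindricLike.RCA.{u} n) β),
      Cardinal.mk Y = β ∧
      CylindricLike.IrredundantlyGenerates (CylindricLike.langCA n) Y ∧
      ¬ CylindricLike.FreelyGenerates (CylindricLike.RCA.{u} n) Y) ∧
    (∃ Y : Set (CylindricLike.Fr (CylindricLike.RSC.{u} n) β),
      Cardinal.mk Y = β ∧
      CylindricLike.IrredundantlyGenerates (CylindricLike.langSC n) Y ∧
      ¬ CylindricLike.FreelyGenerates (CylindricLike.RSC.{u} n) Y) := by
  obtain ⟨x₀⟩ : Nonempty β.out := by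
    rw [← Cardinal.mk_ne_zero_iff, Cardinal.mk_out]
    exact hβ.ne'
  have h01 : (⟨0, by omega⟩ : Fin n) ≠ ⟨1, by omega⟩ := by simp
  have h02 : (⟨0, by omega⟩ : Fin n) ≠ ⟨2, hn⟩ := by simp
  have h12 : (⟨1, by omega⟩ : Fin n) ≠ ⟨2, hn⟩ := by simp
  have hτ := CylindricLike.substDefinable_condShift.{u} h01 h02 h12 hn
  have hσ := CylindricLike.substDefinable_condUnshift.{u} h01 h02 h12 hn
  obtain ⟨b, hb⟩ := CylindricLike.exists_condShift_ne.{u} h01 h02 h12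
  constructor
  · obtain ⟨τ, hτ⟩ := hτ.exists_term_langCA
    obtain ⟨σ, hσ⟩ := hσ.exists_term_langCA
    obtain ⟨Y, hY, h⟩ :=
      CylindricLike.exists_irredundantlyGenerates_not_freelyGenerates (K := CylindricLike.RCA n) τ σ
        (fun A _ ⟨_, U, h, hinj⟩ a =>
          CylindricLike.realize_realize_eq_of_jointly_injective h hinj
            (fun i R => by rw [hτ, hσ, CylindricLike.condUnshift_condShift h01 h02 h12]) a)
        (CylindricLike.RCA_fullCs n _) (fun R => (hτ _ R).trans_ne (hb R)) x₀
    exact ⟨Y, hY.trans (Cardinal.mk_out β), h⟩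
  · obtain ⟨τ, hτ⟩ := hτ.exists_term_langSC
    obtain ⟨σ, hσ⟩ := hσ.exists_term_langSC
    obtain ⟨Y, hY, h⟩ :=
      CylindricLike.exists_irredundantlyGenerates_not_freelyGenerates (K := CylindricLike.RSC n) τ σ
        (fun A _ ⟨_, U, h, hinj⟩ a =>
          CylindricLike.realize_realize_eq_of_jointly_injective h hinj
            (fun i R => by rw [hτ, hσ, CylindricLike.condUnshift_condShift h01 h02 h12]) a)
        (CylindricLike.RSC_fullSubstAlg n _) (fun R => (hτ _ R).trans_ne (hb R)) x₀
    exact ⟨Y, hY.trans (Cardinal.mk_out β), h⟩
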